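/- Let $\mathbb{C}^{2,1}$ be $\mathbb{C}^3$ with the Hermitian form $\langle \mathbf z,\mathbf w\rangle=z_1\overline{w_3}+z_2\overline{w_2}+z_3\overline{w_1}$ of signature $(2,1)$, let $\partial\mathbf H^2_{\mathbb C}\subset\mathbb{CP}^2$ be the projectivisation of the nonzero null vectors ($\langle\mathbf z,\mathbf z\rangle=0$), and let ${\rm PU}(2,1)$ be the image in ${\rm PGL}(3,\mathbb C)$ of the unitary group ${\rm U}(2,1)$ of the form. A $\mathbb C$-circle is the set of points of $\partial\mathbf H^2_{\mathbb C}$ lying in $\mathbb P(W)$, where $W\subset\mathbb{C}^{2,1}$ is a complex plane ($\dim_{\mathbb C}W=2$) containing a vector $\mathbf v$ with $\langle\mathbf v,\mathbf v\rangle<0$. Let $\mathfrak F_4$ be the quotient, by the diagonal action of ${\rm PU}(2,1)$, of the set of ordered quadruples $\mathfrak p=(p_1,p_2,p_3,p_4)$ of pairwise distinct points of $\partial\mathbf H^2_{\mathbb C}$. Let $\mathfrak F_4''\subset\mathfrak F_4$ be the set of classes $[\mathfrak p]$ such that (i) $p_1,p_2,p_3$ do not lie in a common $\mathbb C$-circle,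 and $p_2,p_3,p_4$ do not lie in a common $\mathbb C$-circle; (ii) $p_4$ is not in the orbit of $p_1$ under the subgroup of ${\rm PU}(2,1)$ that fixes both $p_2$ and $p_3$. For lifts $\mathbf p_i$ of $p_i$ put $$\mathbb X(p_1,p_2,p_3,p_4)=\frac{\langle\mathbf p_4,\mathbf p_2\rangle\langle\mathbf p_3,\mathbf p_1\rangle}{\langle\mathbf p_4,\mathbf p_1\rangle\langle\mathbf p_3,\mathbf p_2\rangle},\qquad \mathbb A(p_1,p_2,p_3)=\arg\left(-\langle\mathbf p_1,\mathbf p_2\rangle\langle\mathbf p_2,\mathbf p_3\rangle\langle\mathbf p_3,\mathbf p_1\rangle\right)$$ (these depend neither on the lifts nor on the representative of the ${\rm PU}(2,1)$-orbit), and $$\mathbb X_1(\mathfrak p)=\mathbb X(p_1,p_2,p_3,p_4),\qquad \mathbb X_2(\mathfrak p)=\mathbb X(p_1,p_3,p_2,p_4).$$ Let $\mathfrak V_4$ be the set of $(w_1,w_2,a)\in\mathbb C^2\times(-\pi/2,\pi/2)$ such that $$|w_1+w_2-1|^2=2\,\Re\left(w_1\overline{w_2}(1+e^{-2ia})\right),\quad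 w_1+w_2-1\neq0,\quad \Re\left(w_1\overline{w_2}e^{-ia}\right)>0,\quad \arg(w_1/w_2)\neq2a,$$ where $\arg$ takes values in $(-\pi,\pi]$. Then the map $[\mathfrak p]\mapsto\left(\mathbb X_1(\mathfrak p),\mathbb X_2(\mathfrak p),\mathbb A(p_1,p_2,p_3)\right)$ is a bijection from $\mathfrak F_4''$ onto $\mathfrak V_4$. -/

import Mathlib

open scoped Matrix MatrixGroups LinearAlgebra.Projectivization

noncomputable section

namespace ComplexHyperbolic

/-- The matrix of the Hermitian form of signature `(2, 1)` on `ℂ³`. -/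
def formMatrix : Matrix (Fin 3) (Fin 3) ℂ :=
  !![0, 0, 1; 0, 1, 0; 1, 0, 0]

/-- The Hermitian form `⟨z, w⟩ = w* H z`, linear in `z` and conjugate linear in `w`. -/
def herm (z w : Fin 3 → ℂ) : ℂ := star w ⬝ᵥ (formMatrix *ᵥ z)

theorem herm_apply (z w : Fin 3 → ℂ) :
    herm z w = z 0 * star (w 2) + z 1 * star (w 1) + z 2 * star (w 0) := by
  simp [herm, formMatrix, Matrix.mulVec, dotProduct, Fin.sum_univ_three]
  ring

theorem herm_smul_smul (a b : ℂ) (z w : Fin 3 → ℂ) :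
    herm (a • z) (b • w) = a * star b * herm z w := by
  simp [herm_apply]
  ring

/-- The group `U(2, 1)` of matrices preserving the Hermitian form. -/
def U21 : Subgroup (GL (Fin 3) ℂ) where
  carrier := {g | ∀ z w : Fin 3 → ℂ, herm (g • z) (g • w) = herm z w}
  mul_mem' := by
    intro a b ha hb z w
    rw [mul_smul, mul_smul, ha, hb]
  one_mem' := by
    intro z w
    rw [one_smul, one_smul]
  inv_mem' := by
    intro a ha z w
    rw [← ha (a⁻¹ • z) (a⁻¹ • w), smul_inv_smul, smul_inv_smul]

/-- The group `PU(2, 1)`, that is, the image of `U(2, 1)` in `PGL(3, ℂ)`. -/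
def PU21 : Subgroup PGL(Fin 3, ℂ) :=
  U21.map (QuotientGroup.mk' (Subgroup.center (GL (Fin 3) ℂ)))

/-- Lifts of a point of the projective plane are unique up to a nonzero factor. -/
theorem exists_lift (x : ℙ ℂ (Fin 3 → ℂ)) (v : Fin 3 → ℂ) (hv : v ≠ 0)
    (h : Projectivization.mk ℂ v hv = x) : ∃ a : ℂ, a ≠ 0 ∧ x.rep = a • v := by
  subst h
  obtain ⟨a, ha⟩ := Projectivization.exists_smul_eq_mk_rep ℂ v hv
  exact ⟨a, a.ne_zero, by rw [← ha]; rfl⟩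

/-- Every element of `PU(2, 1)` acts on lifts through an element of `U(2, 1)`. -/
theorem exists_rep_smul (g : PU21) :
    ∃ u ∈ U21, ∀ x : ℙ ℂ (Fin 3 → ℂ), ∃ a : ℂ, a ≠ 0 ∧ (g • x).rep = a • (u • x.rep) := by
  obtain ⟨g, u, hu, rfl⟩ := g
  refine ⟨u, hu, fun x ↦ ?_⟩
  refine exists_lift _ _ ((smul_ne_zero_iff_ne u).2 x.rep_nonzero) ?_
  conv_rhs => rw [← x.mk_rep]
  rfl

/-- The boundary of the complex hyperbolic plane: the projectivisation of the null vectors,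
with the action of `PU(2, 1)`. -/
def boundary : SubMulAction PU21 (ℙ ℂ (Fin 3 → ℂ)) where
  carrier := {x | herm x.rep x.rep = 0}
  smul_mem' := by
    intro g x hx
    obtain ⟨u, hu, h⟩ := exists_rep_smul g
    obtain ⟨a, -, ha⟩ := h x
    simp only [Set.mem_ofPred_eq] at hx ⊢
    rw [ha, herm_smul_smul, hu, hx, mul_zero]

/-- The chosen lift of a boundary point to a nonzero null vector. -/
def lift (x : boundary) : Fin 3 → ℂ := x.1.rep

/-- A `ℂ`-circle: the set of boundary points of a complex geodesic. The latter is given by a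
plane `W` of `ℂ³` that contains a negative vector. -/
def IsCCircle (C : Set boundary) : Prop :=
  ∃ W : Submodule ℂ (Fin 3 → ℂ), Module.finrank ℂ W = 2 ∧ (∃ v ∈ W, (herm v v).re < 0) ∧
    C = {x | x.1.submodule ≤ W}

/-- The three points lie in a common `ℂ`-circle. -/
def InCommonCCircle (x y z : boundary) : Prop :=
  ∃ C : Set boundary, IsCCircle C ∧ x ∈ C ∧ y ∈ C ∧ z ∈ C

/-- The cross-ratio `⟨p₄, p₂⟩⟨p₃, p₁⟩ / (⟨p₄, p₁⟩⟨p₃, p₂⟩)`. -/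
def crossRatio (p₁ p₂ p₃ p₄ : boundary) : ℂ :=
  (herm (lift p₄) (lift p₂) * herm (lift p₃) (lift p₁)) /
    (herm (lift p₄) (lift p₁) * herm (lift p₃) (lift p₂))

/-- Cartan's angular invariant. -/
def cartan (p₁ p₂ p₃ : boundary) : ℝ :=
  Complex.arg (-(herm (lift p₁) (lift p₂) * herm (lift p₂) (lift p₃) * herm (lift p₃) (lift p₁)))

theorem crossRatio_scale (v₁ v₂ v₃ v₄ : Fin 3 → ℂ) {a b c d : ℂ}
    (ha : a ≠ 0) (hb : b ≠ 0) (hc : c ≠ 0) (hd : d ≠ 0) :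
    (herm (d • v₄) (b • v₂) * herm (c • v₃) (a • v₁)) /
      (herm (d • v₄) (a • v₁) * herm (c • v₃) (b • v₂)) =
    (herm v₄ v₂ * herm v₃ v₁) / (herm v₄ v₁ * herm v₃ v₂) := by
  have ha' : star a ≠ 0 := star_ne_zero.2 ha
  have hb' : star b ≠ 0 := star_ne_zero.2 hb
  simp only [herm_smul_smul]
  rw [show d * star b * herm v₄ v₂ * (c * star a * herm v₃ v₁) =
      (d * star b * c * star a) * (herm v₄ v₂ * herm v₃ v₁) by ring,
    show d * star a * herm v₄ v₁ * (c * star b * herm v₃ v₂) =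
      (d * star b * c * star a) * (herm v₄ v₁ * herm v₃ v₂) by ring]
  exact mul_div_mul_left _ _ (by positivity)

theorem cartan_scale (v₁ v₂ v₃ : Fin 3 → ℂ) {a b c : ℂ}
    (ha : a ≠ 0) (hb : b ≠ 0) (hc : c ≠ 0) :
    Complex.arg (-(herm (a • v₁) (b • v₂) * herm (b • v₂) (c • v₃) * herm (c • v₃) (a • v₁))) =
      Complex.arg (-(herm v₁ v₂ * herm v₂ v₃ * herm v₃ v₁)) := by
  have hr : 0 < Complex.normSq a * Complex.normSq b * Complex.normSq c :=
    mul_pos (mul_pos (Complex.normSq_pos.2 ha) (Complex.normSq_pos.2 hb)) (Complex.normSq_pos.2 hc)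
  rw [← Complex.arg_real_mul (-(herm v₁ v₂ * herm v₂ v₃ * herm v₃ v₁)) hr]
  congr 1
  simp only [herm_smul_smul]
  push_cast
  simp only [Complex.normSq_eq_conj_mul_self, Complex.star_def]
  ring

/-- The cross-ratio may be computed with arbitrary lifts. -/
theorem crossRatio_eq (p₁ p₂ p₃ p₄ : boundary) (v₁ v₂ v₃ v₄ : Fin 3 → ℂ)
    (h₁ : v₁ ≠ 0) (h₂ : v₂ ≠ 0) (h₃ : v₃ ≠ 0) (h₄ : v₄ ≠ 0)
    (e₁ : Projectivization.mk ℂ v₁ h₁ = p₁) (e₂ : Projectivization.mk ℂ v₂ h₂ = p₂)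
    (e₃ : Projectivization.mk ℂ v₃ h₃ = p₃) (e₄ : Projectivization.mk ℂ v₄ h₄ = p₄) :
    crossRatio p₁ p₂ p₃ p₄ = (herm v₄ v₂ * herm v₃ v₁) / (herm v₄ v₁ * herm v₃ v₂) := by
  obtain ⟨a, ha, ea⟩ := exists_lift _ v₁ h₁ e₁
  obtain ⟨b, hb, eb⟩ := exists_lift _ v₂ h₂ e₂
  obtain ⟨c, hc, ec⟩ := exists_lift _ v₃ h₃ e₃
  obtain ⟨d, hd, ed⟩ := exists_lift _ v₄ h₄ e₄
  rw [crossRatio, lift, lift, lift, lift, ea, eb, ec, ed, crossRatio_scale _ _ _ _ ha hb hc hd]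

/-- Cartan's angular invariant may be computed with arbitrary lifts. -/
theorem cartan_eq (p₁ p₂ p₃ : boundary) (v₁ v₂ v₃ : Fin 3 → ℂ)
    (h₁ : v₁ ≠ 0) (h₂ : v₂ ≠ 0) (h₃ : v₃ ≠ 0)
    (e₁ : Projectivization.mk ℂ v₁ h₁ = p₁) (e₂ : Projectivization.mk ℂ v₂ h₂ = p₂)
    (e₃ : Projectivization.mk ℂ v₃ h₃ = p₃) :
    cartan p₁ p₂ p₃ = Complex.arg (-(herm v₁ v₂ * herm v₂ v₃ * herm v₃ v₁)) := by
  obtain ⟨a, ha, ea⟩ := exists_lift _ v₁ h₁ e₁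
  obtain ⟨b, hb, eb⟩ := exists_lift _ v₂ h₂ e₂
  obtain ⟨c, hc, ec⟩ := exists_lift _ v₃ h₃ e₃
  rw [cartan, lift, lift, lift, ea, eb, ec, cartan_scale _ _ _ ha hb hc]

theorem crossRatio_smul (g : PU21) (p₁ p₂ p₃ p₄ : boundary) :
    crossRatio (g • p₁) (g • p₂) (g • p₃) (g • p₄) = crossRatio p₁ p₂ p₃ p₄ := by
  obtain ⟨u, hu, h⟩ := exists_rep_smul g
  obtain ⟨a, ha, ea⟩ := h p₁
  obtain ⟨b, hb, eb⟩ := h p₂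
  obtain ⟨c, hc, ec⟩ := h p₃
  obtain ⟨d, hd, ed⟩ := h p₄
  simp only [crossRatio, lift, SubMulAction.val_smul, ea, eb, ec, ed]
  rw [crossRatio_scale _ _ _ _ ha hb hc hd, hu, hu, hu, hu]

theorem cartan_smul (g : PU21) (p₁ p₂ p₃ : boundary) :
    cartan (g • p₁) (g • p₂) (g • p₃) = cartan p₁ p₂ p₃ := by
  obtain ⟨u, hu, h⟩ := exists_rep_smul g
  obtain ⟨a, ha, ea⟩ := h p₁
  obtain ⟨b, hb, eb⟩ := h p₂
  obtain ⟨c, hc, ec⟩ := h p₃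
  simp only [cartan, lift, SubMulAction.val_smul, ea, eb, ec]
  rw [cartan_scale _ _ _ ha hb hc, hu, hu, hu]

/-- Ordered quadruples of pairwise distinct boundary points; `PU(2, 1)` acts diagonally.
The points `p₁, p₂, p₃, p₄` are `p 0, p 1, p 2, p 3`. -/
abbrev C4 : Type := Fin 4 ↪ boundary

/-- The configuration space of four boundary points. -/
abbrev F4 : Type := MulAction.orbitRel.Quotient PU21 C4

/-- The configuration of a quadruple. -/
def config (p : C4) : F4 := Quotient.mk _ p

/-- The quadruples such that neither `p₁, p₂, p₃` nor `p₂, p₃, p₄` lie in a common `ℂ`-circle,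
and `p₁, p₄` are not in the same orbit of the (pointwise) stabiliser of `p₂` and `p₃`. -/
def C4'' : Set C4 :=
  {p | ¬ InCommonCCircle (p 0) (p 1) (p 2) ∧ ¬ InCommonCCircle (p 1) (p 2) (p 3) ∧
    p 3 ∉ MulAction.orbit
      (MulAction.stabilizer PU21 (p 1) ⊓ MulAction.stabilizer PU21 (p 2) : Subgroup PU21) (p 0)}

/-- The set of configurations of the quadruples in `C4''`. -/
def F4'' : Set F4 := config '' C4''

/-- The first cross-ratio `𝕏(p₁, p₂, p₃, p₄)`. -/
def X1 (p : C4) : ℂ := crossRatio (p 0) (p 1) (p 2) (p 3)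

/-- The second cross-ratio `𝕏(p₁, p₃, p₂, p₄)`. -/
def X2 (p : C4) : ℂ := crossRatio (p 0) (p 2) (p 1) (p 3)

/-- The map `[p] ↦ (𝕏₁(p), 𝕏₂(p), 𝔸(p₁, p₂, p₃))` on configurations. -/
def B0 : F4 → ℂ × ℂ × ℝ :=
  Quotient.lift (fun p : C4 ↦ (X1 p, X2 p, cartan (p 0) (p 1) (p 2))) (by
    rintro _ p ⟨g, rfl⟩
    simp only [X1, X2, Function.Embedding.smul_apply, crossRatio_smul, cartan_smul])

/-- The variety `𝔙₄` in `ℂ² × (-π/2, π/2)`. -/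
def V4 : Set (ℂ × ℂ × ℝ) :=
  {x | x.2.2 ∈ Set.Ioo (-(Real.pi / 2)) (Real.pi / 2) ∧
    ‖x.1 + x.2.1 - 1‖ ^ 2 =
      2 * (x.1 * star x.2.1 * (1 + Complex.exp (-2 * Complex.I * (x.2.2 : ℂ)))).re ∧
    x.1 + x.2.1 - 1 ≠ 0 ∧
    0 < (x.1 * star x.2.1 * Complex.exp (-Complex.I * (x.2.2 : ℂ))).re ∧
    Complex.arg (x.1 / x.2.1) ≠ 2 * x.2.2}

end ComplexHyperbolic

end

open scoped Matrix MatrixGroups LinearAlgebra.Projectivization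

noncomputable section

namespace ComplexHyperbolic

/-! Write e₁ = (1,0,0) and e₃ = (0,0,1). U(2,1) is transitive on ordered pairs of distinct null
lines, so p₂, p₃ may be moved to [e₁], [e₃] (`exists_frame`). The points of the ℂ-circle through
these two are those with middle coordinate 0. On the other boundary points the torus diag(s, b,
s⁻¹), s > 0, |b| = 1, leaves only one invariant, the Cartan angle a in (-π/2, π/2). Hence p₁ becomes
[`zeta a`] (`exists_torus`, `exists_frame_triple`).

Once p₄ is scaled to have product 1 with `zeta a`, its outer coordinates are given by the two
cross-ratios and its middle one by the scaling. Thus p₄ = [`omega X₁ X₂ a`]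
(`exists_frame_quadruple`), and the invariants determine the class.

The conditions of 𝔙₄ translate term by term. The equation says that `omega` is null
(`omega_null_iff`), and w₁ + w₂ ≠ 1 says that its middle coordinate is nonzero. The number u = w₁
w̄₂ e^{-ia} has argument 𝔸(p₄, p₂, p₃) (`cartan_omega`), so Re u > 0 puts this angle in (-π/2, π/2),
and arg(w₁/w₂) ≠ 2a says that it differs from a (`arg_div_eq`). By `exists_smul_eq_of_cartan_eq`
that is condition (ii). -/

/-! ### Lifts of boundary points and the action on them. -/

/-- The vector `v` is a lift of the boundary point `p`. -/
def IsLift (p : boundary) (v : Fin 3 → ℂ) : Prop :=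
  ∃ h : v ≠ 0, Projectivization.mk ℂ v h = p.1

theorem isLift_lift (p : boundary) : IsLift p (lift p) :=
  ⟨p.1.rep_nonzero, p.1.mk_rep⟩

namespace IsLift

variable {p q : boundary} {v w : Fin 3 → ℂ}

theorem herm_self (h : IsLift p v) : herm v v = 0 := by
  obtain ⟨h0, h⟩ := h
  obtain ⟨a, ha, e⟩ := exists_lift _ v h0 h
  have h1 : herm p.1.rep p.1.rep = 0 := p.2
  rw [e, herm_smul_smul] at h1
  simpa [ha] using h1

theorem smul (h : IsLift p v) {a : ℂ} (ha : a ≠ 0) : IsLift p (a • v) := by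
  obtain ⟨h0, h⟩ := h
  refine ⟨smul_ne_zero ha h0, ?_⟩
  rw [← h, Projectivization.mk_eq_mk_iff']
  exact ⟨a, rfl⟩

theorem of_smul {a : ℂ} (h : IsLift p (a • v)) : IsLift p v := by
  have ha : a ≠ 0 := by
    rintro rfl
    exact h.1 (zero_smul _ _)
  simpa [smul_smul, ha] using h.smul (inv_ne_zero ha)

theorem unique (h : IsLift p v) (h' : IsLift q v) : p = q := by
  obtain ⟨h0, h⟩ := h
  obtain ⟨h0', h'⟩ := h'
  exact Subtype.ext (h.symm.trans h')

theorem mem_submodule (h : IsLift p v) : v ∈ p.1.submodule := by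
  obtain ⟨h0, h⟩ := h
  rw [← h, Projectivization.submodule_mk]
  exact Submodule.mem_span_singleton_self v

theorem submodule_le (h : IsLift p v) {W : Submodule ℂ (Fin 3 → ℂ)} (hv : v ∈ W) :
    p.1.submodule ≤ W := by
  obtain ⟨h0, h⟩ := h
  rw [← h, Projectivization.submodule_mk, Submodule.span_singleton_le_iff_mem]
  exact hv

end IsLift

theorem exists_isLift {v : Fin 3 → ℂ} (h : v ≠ 0) (h0 : herm v v = 0) : ∃ p, IsLift p v := by
  obtain ⟨a, -, e⟩ := exists_lift _ v h rfl
  refine ⟨⟨Projectivization.mk ℂ v h, ?_⟩, h, rfl⟩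
  change herm (Projectivization.mk ℂ v h).rep (Projectivization.mk ℂ v h).rep = 0
  rw [e, herm_smul_smul, h0, mul_zero]

/-- The class in `PU(2, 1)` of an element of `U(2, 1)`. -/
def toPU (g : GL (Fin 3) ℂ) (hg : g ∈ U21) : PU21 :=
  ⟨QuotientGroup.mk' _ g, g, hg, rfl⟩

theorem IsLift.toPU_smul {p : boundary} {v : Fin 3 → ℂ} (h : IsLift p v) {g : GL (Fin 3) ℂ}
    (hg : g ∈ U21) : IsLift (toPU g hg • p) (g • v) := by
  obtain ⟨h0, h⟩ := h
  refine ⟨(smul_ne_zero_iff_ne g).2 h0, ?_⟩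
  rw [SubMulAction.val_smul, ← h]
  rfl

theorem crossRatio_eq_of_isLift {p₁ p₂ p₃ p₄ : boundary} {v₁ v₂ v₃ v₄ : Fin 3 → ℂ}
    (h₁ : IsLift p₁ v₁) (h₂ : IsLift p₂ v₂) (h₃ : IsLift p₃ v₃) (h₄ : IsLift p₄ v₄) :
    crossRatio p₁ p₂ p₃ p₄ = (herm v₄ v₂ * herm v₃ v₁) / (herm v₄ v₁ * herm v₃ v₂) :=
  crossRatio_eq _ _ _ _ _ _ _ _ h₁.1 h₂.1 h₃.1 h₄.1 h₁.2 h₂.2 h₃.2 h₄.2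

theorem cartan_eq_of_isLift {p₁ p₂ p₃ : boundary} {v₁ v₂ v₃ : Fin 3 → ℂ}
    (h₁ : IsLift p₁ v₁) (h₂ : IsLift p₂ v₂) (h₃ : IsLift p₃ v₃) :
    cartan p₁ p₂ p₃ = Complex.arg (-(herm v₁ v₂ * herm v₂ v₃ * herm v₃ v₁)) :=
  cartan_eq _ _ _ _ _ _ h₁.1 h₂.1 h₃.1 h₁.2 h₂.2 h₃.2

/-! ### Orthogonality of null vectors. -/

/-- Two null vectors orthogonal to each other are proportional. -/
theorem exists_smul_eq_of_herm_eq_zero {u v : Fin 3 → ℂ} (hu : u ≠ 0) (huu : herm u u = 0)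
    (hvv : herm v v = 0) (huv : herm u v = 0) : ∃ a : ℂ, v = a • u := by
  simp only [herm_apply, Complex.star_def] at huu hvv huv
  have key : ∀ x : ℂ, x * starRingEnd ℂ x = 0 → x = 0 := fun x h ↦ by simpa using h
  by_cases h2 : u 2 = 0
  · have h1 : u 1 = 0 := key _ (by simpa [h2] using huu)
    have h0 : u 0 ≠ 0 := fun h0 ↦ hu (by ext i; fin_cases i <;> assumption)
    have v2 : v 2 = 0 := by simpa [h2, h1, h0] using huv
    have v1 : v 1 = 0 := key _ (by simpa [v2] using hvv)
    refine ⟨v 0 / u 0, ?_⟩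
    ext i
    fin_cases i <;> simp [h0, h1, h2, v1, v2]
  · have h2' : starRingEnd ℂ (u 2) ≠ 0 := by simpa using h2
    have huv' := congrArg (starRingEnd ℂ) huv
    simp only [map_add, map_mul, Complex.conj_conj, map_zero] at huv'
    -- The vector v - (v₂/u₂)u is null, as all products among u and v vanish. Its last coordinate is
    -- 0, so its middle coordinate has modulus 0.
    have e1 : v 1 - v 2 / u 2 * u 1 = 0 := by
      apply key
      simp only [map_sub, map_mul, map_div₀]
      field_simp
      linear_combination u 2 * starRingEnd ℂ (u 2) * hvv + v 2 * starRingEnd ℂ (v 2) * huu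
        - v 2 * starRingEnd ℂ (u 2) * huv - u 2 * starRingEnd ℂ (v 2) * huv'
    refine ⟨v 2 / u 2, ?_⟩
    have e1' : v 1 = v 2 / u 2 * u 1 := sub_eq_zero.1 e1
    ext i
    fin_cases i
    · simp only [Fin.mk_zero, Pi.smul_apply, smul_eq_mul]
      rw [e1'] at huv'
      field_simp at huv' ⊢
      apply mul_right_cancel₀ h2'
      linear_combination huv' - v 2 * huu
    · simpa using e1'
    · simp [h2]

/-- Signature (2,1) leaves no totally isotropic plane, so orthogonal null lines coincide. -/
theorem IsLift.herm_ne_zero {p q : boundary} {v w : Fin 3 → ℂ} (hp : IsLift p v) (hq : IsLift q w)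
    (h : p ≠ q) : herm v w ≠ 0 := by
  intro h0
  obtain ⟨a, rfl⟩ := exists_smul_eq_of_herm_eq_zero hp.1 hp.herm_self hq.herm_self h0
  exact h (hp.unique hq.of_smul)

theorem IsLift.ne_of_herm_ne_zero {p q : boundary} {v w : Fin 3 → ℂ} (hp : IsLift p v)
    (hq : IsLift q w) (h : herm v w ≠ 0) : p ≠ q := by
  rintro rfl
  obtain ⟨hv, e⟩ := hp
  obtain ⟨hw, e'⟩ := hq
  obtain ⟨a, rfl⟩ := (Projectivization.mk_eq_mk_iff' ℂ v w hv hw).1 (e.trans e'.symm)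
  apply h
  have := herm_smul_smul a 1 w w
  rw [one_smul] at this
  rw [this, IsLift.herm_self ⟨hw, e'⟩, mul_zero]

/-! ### Frames and transitivity on pairs. -/

/-- A frame with the Gram matrix of the form gives an element of `U(2, 1)`. -/
theorem exists_mem_U21 (a b c : Fin 3 → ℂ) (haa : herm a a = 0) (hbb : herm b b = 1)
    (hcc : herm c c = 0) (hab : herm a b = 0) (hac : herm a c = 1) (hbc : herm b c = 0) :
    ∃ g ∈ U21, ∀ z : Fin 3 → ℂ, g • z = z 0 • a + z 1 • b + z 2 • c := by
  set A : Matrix (Fin 3) (Fin 3) ℂ := (Matrix.of ![a, b, c])ᵀ with hA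
  have hmul : ∀ z, A *ᵥ z = z 0 • a + z 1 • b + z 2 • c := by
    intro z
    ext i
    simp [hA, Matrix.mulVec, dotProduct, Fin.sum_univ_three]
    ring
  have hherm : ∀ z w, herm (A *ᵥ z) (A *ᵥ w) = herm z w := by
    intro z w
    have hab' := congrArg star hab
    have hac' := congrArg star hac
    have hbc' := congrArg star hbc
    rw [hmul, hmul]
    simp only [herm_apply, Complex.star_def, Pi.add_apply, Pi.smul_apply, smul_eq_mul, map_add,
      map_mul, Complex.conj_conj, map_zero, map_one] at *
    linear_combination z 0 * starRingEnd ℂ (w 0) * haa + z 1 * starRingEnd ℂ (w 1) * hbb +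
      z 2 * starRingEnd ℂ (w 2) * hcc + z 0 * starRingEnd ℂ (w 1) * hab +
      z 0 * starRingEnd ℂ (w 2) * hac + z 1 * starRingEnd ℂ (w 2) * hbc +
      z 1 * starRingEnd ℂ (w 0) * hab' + z 2 * starRingEnd ℂ (w 0) * hac' +
      z 2 * starRingEnd ℂ (w 1) * hbc'
  have hdet : A.det ≠ 0 := by
    intro h0
    obtain ⟨z, hz, h⟩ := Matrix.exists_mulVec_eq_zero_iff.2 h0
    apply hz
    have key : ∀ w, herm z w = 0 := fun w ↦ by
      rw [← hherm, h, herm_apply]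
      simp
    have k0 := key ![0, 0, 1]
    have k1 := key ![0, 1, 0]
    have k2 := key ![1, 0, 0]
    ext i
    fin_cases i
    · simpa [herm_apply] using k0
    · simpa [herm_apply] using k1
    · simpa [herm_apply] using k2
  exact ⟨Matrix.GeneralLinearGroup.mkOfDetNeZero A hdet, hherm, hmul⟩

/-- `U(2, 1)` acts transitively on pairs of distinct boundary points. -/
theorem exists_frame {u v : Fin 3 → ℂ} (huu : herm u u = 0) (hvv : herm v v = 0)
    (huv : herm u v ≠ 0) :
    ∃ g ∈ U21, ∀ z : Fin 3 → ℂ, z 1 = 0 → g • z = (z 0 / herm u v) • u + z 2 • v := by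
  set s := herm u v with hs
  set r : ℂ := ((‖s‖ : ℝ) : ℂ) with hr
  have hr0 : r ≠ 0 := by simpa [hr] using huv
  have hrr : r * r = s * star s := by
    rw [Complex.star_def, Complex.mul_conj, Complex.normSq_eq_norm_sq, hr]
    push_cast
    ring
  have hrs : star r = r := by simp [hr]
  -- The Hermitian cross product: the usual one, conjugated and with its coordinates reversed to
  -- match the form. It is orthogonal to u and v, and ⟨n,n⟩ = |⟨u,v⟩|² - ⟨u,u⟩⟨v,v⟩.
  set n : Fin 3 → ℂ := star ![u 0 * v 1 - u 1 * v 0, u 2 * v 0 - u 0 * v 2,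
    u 1 * v 2 - u 2 * v 1] with hn
  have hun : herm u n = 0 := by
    simp [hn, herm_apply]
    ring
  have hvn : herm v n = 0 := by
    simp [hn, herm_apply]
    ring
  have hnv : herm n v = 0 := by
    have := congrArg star hvn
    simp only [herm_apply, Complex.star_def, map_add, map_mul, Complex.conj_conj, map_zero] at *
    linear_combination this
  have hnn : herm n n = s * star s := by
    rw [hs]
    simp only [herm_apply, hn, Complex.star_def, Pi.star_apply, Matrix.cons_val_zero,
      Matrix.cons_val_one, Matrix.cons_val, map_add, map_mul, map_sub,
      Complex.conj_conj] at huu hvv ⊢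
    linear_combination -(v 0 * starRingEnd ℂ (v 2) + v 1 * starRingEnd ℂ (v 1) +
      v 2 * starRingEnd ℂ (v 0)) * huu
  obtain ⟨g, hg, h⟩ := exists_mem_U21 (s⁻¹ • u) (r⁻¹ • n) v
    (by rw [herm_smul_smul, huu, mul_zero])
    (by rw [herm_smul_smul, hnn, ← hrr, star_inv₀, hrs]; field_simp)
    hvv
    (by rw [herm_smul_smul, hun, mul_zero])
    (by have := herm_smul_smul s⁻¹ 1 u v
        rw [one_smul] at this
        rw [this, ← hs, star_one, mul_one, inv_mul_cancel₀ huv])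
    (by have := herm_smul_smul r⁻¹ 1 n v
        rw [one_smul] at this
        rw [this, hnv, mul_zero])
  refine ⟨g, hg, fun z hz ↦ ?_⟩
  rw [h, hz, zero_smul, add_zero, smul_smul, div_eq_mul_inv]

/-! ### Normal form of triples and the Cartan invariant. -/

/-- The first point of the normal form of a triple with angular invariant `a`. -/
def zeta (a : ℝ) : Fin 3 → ℂ :=
  ![-Complex.exp (-Complex.I * a), (√(2 * Real.cos a) : ℝ), 1]

/-- The fourth point of the normal form of a quadruple with given invariants. -/
def omega (x₁ x₂ : ℂ) (a : ℝ) : Fin 3 → ℂ :=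
  ![x₂, -(x₁ + x₂ - 1) / (√(2 * Real.cos a) : ℝ), -Complex.exp (-Complex.I * a) * x₁]

theorem conj_exp_neg_I_mul (a : ℝ) :
    starRingEnd ℂ (Complex.exp (-Complex.I * a)) = Complex.exp (Complex.I * a) := by
  rw [← Complex.exp_conj]
  simp

theorem exp_I_mul_exp_neg_I (a : ℝ) :
    Complex.exp (Complex.I * a) * Complex.exp (-Complex.I * a) = 1 := by
  rw [← Complex.exp_add]
  simp

/-- A null vector is determined up to the torus by the argument of its normal form. -/
theorem exists_torus {z : Fin 3 → ℂ} (hz : herm z z = 0) (h1 : z 1 ≠ 0) :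
    ∃ d ∈ U21, ∃ a ∈ Set.Ioo (-(Real.pi / 2)) (Real.pi / 2), ∃ α β c : ℂ,
      d • (![1, 0, 0] : Fin 3 → ℂ) = α • ![1, 0, 0] ∧ d • (![0, 0, 1] : Fin 3 → ℂ) = β • ![0, 0, 1] ∧
      z = c • (d • zeta a) := by
  have hn1 : 0 < Complex.normSq (z 1) := Complex.normSq_pos.2 h1
  have hre : (z 0 * starRingEnd ℂ (z 2)).re = -(Complex.normSq (z 1) / 2) := by
    have := congrArg Complex.re hz
    simp only [herm_apply, Complex.star_def, Complex.mul_re, Complex.conj_re, Complex.conj_im,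
      Complex.add_re, Complex.zero_re, Complex.normSq_apply] at this ⊢
    linarith
  have h2 : z 2 ≠ 0 := by
    intro h2
    simp [h2] at hre
    exact h1 hre
  have hn2 : 0 < Complex.normSq (z 2) := Complex.normSq_pos.2 h2
  -- Nullity reads 2 Re(z₀ z̄₂) = -|z₁|² < 0, so y has positive real part and its argument lies in
  -- (-π/2, π/2).
  set y : ℂ := -(z 0 / z 2) with hy
  have hyre : y.re = Complex.normSq (z 1) / Complex.normSq (z 2) / 2 := by
    have : y = ((-(Complex.normSq (z 2))⁻¹ : ℝ) : ℂ) * (z 0 * starRingEnd ℂ (z 2)) := by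
      rw [hy, div_eq_mul_inv, Complex.inv_def]
      push_cast
      ring
    rw [this, Complex.re_ofReal_mul, hre]
    field_simp
  have hypos : 0 < y.re := by rw [hyre]; positivity
  have hy0 : y ≠ 0 := by
    intro h
    simp [h] at hypos
  set a : ℝ := -y.arg with ha
  have haI : a ∈ Set.Ioo (-(Real.pi / 2)) (Real.pi / 2) := by
    have := abs_lt.1 (Complex.abs_arg_lt_pi_div_two_iff.2 (Or.inl hypos))
    constructor <;> linarith [this.1, this.2]
  have hcos : 0 < Real.cos a := Real.cos_pos_of_mem_Ioo haI
  have hyexp : y = (‖y‖ : ℝ) * Complex.exp (-Complex.I * a) := by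
    conv_lhs => rw [← Complex.norm_mul_exp_arg_mul_I y]
    congr 2
    rw [ha]
    push_cast
    ring
  have hycos : ‖y‖ * Real.cos a = Complex.normSq (z 1) / Complex.normSq (z 2) / 2 := by
    rw [← hyre, ha, Real.cos_neg, Complex.norm_mul_cos_arg]
  -- Solving z = c · diag(s, b, s⁻¹) · `zeta a` forces c = z₂ s, s² = |y| and the b below. Nullity
  -- of z then gives |b| = 1.
  set s : ℝ := √‖y‖ with hs
  have hs0 : 0 < s := Real.sqrt_pos.2 (norm_pos_iff.2 hy0)
  have hss : s * s = ‖y‖ := Real.mul_self_sqrt (norm_nonneg _)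
  set t : ℝ := √(2 * Real.cos a) with ht
  have ht0 : 0 < t := Real.sqrt_pos.2 (by positivity)
  have htt : t * t = 2 * Real.cos a := Real.mul_self_sqrt (by positivity)
  have hsC : (s : ℂ) ≠ 0 := by exact_mod_cast hs0.ne'
  have htC : (t : ℂ) ≠ 0 := by exact_mod_cast ht0.ne'
  set b : ℂ := z 1 / (z 2 * s * t) with hb
  have hbb : b * starRingEnd ℂ b = 1 := by
    have h3 : Complex.normSq b = 1 := by
      rw [hb, map_div₀, map_mul, map_mul, Complex.normSq_ofReal, Complex.normSq_ofReal, htt, hss,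
        div_eq_one_iff_eq (by positivity)]
      field_simp at hycos
      linarith
    rw [Complex.mul_conj, h3, Complex.ofReal_one]
  obtain ⟨d, hd, h⟩ := exists_mem_U21 ![(s : ℂ), 0, 0] ![0, b, 0] ![0, 0, (s : ℂ)⁻¹]
    (by simp [herm_apply]) (by simp [herm_apply, hbb]) (by simp [herm_apply])
    (by simp [herm_apply]) (by simp [herm_apply, hsC]) (by simp [herm_apply])
  refine ⟨d, hd, a, haI, s, (s : ℂ)⁻¹, z 2 * s, ?_, ?_, ?_⟩
  · rw [h]
    ext i
    fin_cases i <;> simp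
  · rw [h]
    ext i
    fin_cases i <;> simp
  · rw [h]
    have hz0 : z 0 = -(z 2 * y) := by rw [hy]; field_simp
    have hssC : (s : ℂ) * s = (‖y‖ : ℝ) := by rw [← hss]; push_cast; rfl
    ext i
    fin_cases i
    · simp [zeta]
      rw [hz0, hyexp, ← hssC]
      ring_nf
    · simp [zeta, ← ht, hb]
      field_simp
    · simp [zeta, hsC]

/-- Triples outside `ℂ`-circles have a normal form. -/
theorem exists_frame_triple {p q r : boundary} (h : ¬ InCommonCCircle p q r) (hqr : q ≠ r) :
    ∃ g ∈ U21, ∃ a ∈ Set.Ioo (-(Real.pi / 2)) (Real.pi / 2),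
      IsLift p (g • zeta a) ∧ IsLift q (g • ![1, 0, 0]) ∧ IsLift r (g • ![0, 0, 1]) := by
  have hq := isLift_lift q
  have hr := isLift_lift r
  have hqr0 := hq.herm_ne_zero hr hqr
  obtain ⟨g, hg, hgz⟩ := exists_frame hq.herm_self hr.herm_self hqr0
  have e0 : g • (![1, 0, 0] : Fin 3 → ℂ) = (herm (lift q) (lift r))⁻¹ • lift q := by
    rw [hgz _ (by simp)]
    simp
  have e2 : g • (![0, 0, 1] : Fin 3 → ℂ) = lift r := by
    rw [hgz _ (by simp)]
    simp
  have hq' : IsLift q (g • ![1, 0, 0]) := e0 ▸ hq.smul (inv_ne_zero hqr0)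
  have hr' : IsLift r (g • ![0, 0, 1]) := e2 ▸ hr
  set z := g⁻¹ • lift p with hz
  have hgz' : g • z = lift p := smul_inv_smul g _
  have hzz : herm z z = 0 := by
    rw [← hg, hgz', (isLift_lift p).herm_self]
  -- Otherwise the lift of p lies in the plane spanned by those of q and r, which also contains the
  -- image of (1,0,-1), of norm -2.
  have hz1 : z 1 ≠ 0 := by
    intro hz1
    apply h
    refine ⟨_, ⟨Submodule.span ℂ (Set.range ![lift q, lift r]), ?_, ?_, rfl⟩, ?_, ?_, ?_⟩
    · rw [finrank_span_eq_card, Fintype.card_fin]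
      rw [LinearIndependent.pair_iff]
      intro s t hst
      have c1 : herm (s • lift q + t • lift r) (lift r) = s * herm (lift q) (lift r) := by
        have := hr.herm_self
        simp only [herm_apply, Pi.add_apply, Pi.smul_apply, smul_eq_mul] at *
        linear_combination t * this
      have hs : s = 0 := by
        rw [hst, show herm 0 (lift r) = 0 by simp [herm]] at c1
        exact (mul_eq_zero.1 c1.symm).resolve_right hqr0
      refine ⟨hs, ?_⟩
      rw [hs, zero_smul, zero_add] at hst
      exact (smul_eq_zero.1 hst).resolve_right hr.1
    · refine ⟨g • ![1, 0, -1], ?_, ?_⟩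
      · rw [hgz _ (by simp)]
        refine Submodule.add_mem _ (Submodule.smul_mem _ _ (Submodule.subset_span ⟨0, rfl⟩))
          (Submodule.smul_mem _ _ (Submodule.subset_span ⟨1, rfl⟩))
      · rw [hg]
        simp [herm_apply]
    · refine (isLift_lift p).submodule_le ?_
      rw [← hgz', hgz _ hz1]
      exact Submodule.add_mem _ (Submodule.smul_mem _ _ (Submodule.subset_span ⟨0, rfl⟩))
          (Submodule.smul_mem _ _ (Submodule.subset_span ⟨1, rfl⟩))
    · exact hq.submodule_le (Submodule.subset_span ⟨0, rfl⟩)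
    · exact hr.submodule_le (Submodule.subset_span ⟨1, rfl⟩)
  obtain ⟨d, hd, a, ha, α, β, c, h0, h2, hc⟩ := exists_torus hzz hz1
  refine ⟨g * d, U21.mul_mem hg hd, a, ha, ?_, ?_, ?_⟩
  · have hp := isLift_lift p
    rw [← hgz', hc, smul_comm] at hp
    rw [mul_smul]
    exact hp.of_smul
  · have hα : α ≠ 0 := by
      rintro rfl
      rw [zero_smul, smul_eq_zero_iff_eq] at h0
      simpa using congrFun h0 0
    rw [mul_smul, h0, smul_comm]
    exact hq'.smul hα
  · have hβ : β ≠ 0 := by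
      rintro rfl
      rw [zero_smul, smul_eq_zero_iff_eq] at h2
      simpa using congrFun h2 2
    rw [mul_smul, h2, smul_comm]
    exact hr'.smul hβ

theorem cartan_eq_of_frame {p q r : boundary} {g : GL (Fin 3) ℂ} (hg : g ∈ U21)
    {a : ℝ} (ha : a ∈ Set.Ioo (-(Real.pi / 2)) (Real.pi / 2)) (hp : IsLift p (g • zeta a))
    (hq : IsLift q (g • ![1, 0, 0])) (hr : IsLift r (g • ![0, 0, 1])) : cartan p q r = a := by
  rw [cartan_eq_of_isLift hp hq hr, hg, hg, hg]
  -- The negated triple product is exactly e^{ia}.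
  have : -(herm (zeta a) ![1, 0, 0] * herm ![1, 0, 0] ![0, 0, 1] * herm ![0, 0, 1] (zeta a)) =
      ((1 : ℝ) : ℂ) * (Complex.cos a + Complex.sin a * Complex.I) := by
    simp only [herm_apply, zeta, Complex.star_def]
    simp [← Complex.exp_conj]
    rw [mul_comm, Complex.exp_mul_I]
  rw [this, Complex.arg_mul_cos_add_sin_mul_I one_pos]
  constructor <;> linarith [ha.1, ha.2, Real.pi_pos]

/-- Triples with the same angular invariant are congruent. -/
theorem exists_smul_eq_of_cartan_eq {p p' q r : boundary} (h : ¬ InCommonCCircle p q r)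
    (h' : ¬ InCommonCCircle p' q r) (hqr : q ≠ r) (hc : cartan p q r = cartan p' q r) :
    ∃ k : PU21, k • p = p' ∧ k • q = q ∧ k • r = r := by
  obtain ⟨g, hg, a, ha, hp, hq, hr⟩ := exists_frame_triple h hqr
  obtain ⟨g', hg', a', ha', hp', hq', hr'⟩ := exists_frame_triple h' hqr
  rw [cartan_eq_of_frame hg ha hp hq hr, cartan_eq_of_frame hg' ha' hp' hq' hr'] at hc
  subst hc
  have hk : g' * g⁻¹ ∈ U21 := U21.mul_mem hg' (U21.inv_mem hg)
  refine ⟨toPU _ hk, (hp.toPU_smul hk).unique ?_, (hq.toPU_smul hk).unique ?_,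
    (hr.toPU_smul hk).unique ?_⟩
  all_goals rwa [mul_smul, inv_smul_smul]

theorem InCommonCCircle.rotate {p q r : boundary} (h : InCommonCCircle p q r) :
    InCommonCCircle q r p := by
  obtain ⟨C, hC, hp, hq, hr⟩ := h
  exact ⟨C, hC, hq, hr, hp⟩

/-- A vector with nonzero middle coordinate spans ℂ³ together with e₁ and e₃, so no plane contains
all three. -/
theorem not_inCommonCCircle {p q r : boundary} {z : Fin 3 → ℂ} (hz : z 1 ≠ 0) (hp : IsLift p z)
    (hq : IsLift q ![1, 0, 0]) (hr : IsLift r ![0, 0, 1]) : ¬ InCommonCCircle p q r := by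
  rintro ⟨_, ⟨W, hW, -, rfl⟩, hpC, hqC, hrC⟩
  have hp' : z ∈ W := hpC hp.mem_submodule
  have hq' : ![1, 0, 0] ∈ W := hqC hq.mem_submodule
  have hr' : ![0, 0, 1] ∈ W := hrC hr.mem_submodule
  have htop : W = ⊤ := by
    rw [eq_top_iff]
    intro v _
    have : v = (v 1 / z 1) • z + (v 0 - v 1 / z 1 * z 0) • ![1, 0, 0] +
        (v 2 - v 1 / z 1 * z 2) • ![0, 0, 1] := by
      ext i
      fin_cases i <;> simp [hz, Matrix.vecHead, Matrix.vecTail]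
    rw [this]
    exact W.add_mem (W.add_mem (W.smul_mem _ hp') (W.smul_mem _ hq')) (W.smul_mem _ hr')
  rw [htop, finrank_top] at hW
  simp at hW

/-! ### The conditions of 𝔙₄ in terms of the normal form. -/

theorem two_cos_eq (a : ℝ) :
    1 + Complex.exp (-2 * Complex.I * a) =
      Complex.exp (-Complex.I * a) * ((2 * Real.cos a : ℝ) : ℂ) := by
  have h1 : Complex.exp (-2 * Complex.I * a) =
      Complex.exp (-Complex.I * a) * Complex.exp (-Complex.I * a) := by
    rw [← Complex.exp_add]
    ring_nf
  have h2 : ((2 * Real.cos a : ℝ) : ℂ) =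
      Complex.exp (Complex.I * a) + Complex.exp (-Complex.I * a) := by
    push_cast
    rw [Complex.two_cos]
    ring_nf
  rw [h1, h2, mul_add, mul_comm _ (Complex.exp (Complex.I * a)), exp_I_mul_exp_neg_I]

/-- This turns the equation of 𝔙₄ into |w₁ + w₂ - 1|² = 4 cos a · Re(w₁ w̄₂ e^{-ia}), whose right
side comes straight from the outer coordinates of `omega`. -/
theorem re_mul_one_add_exp (y : ℂ) (a : ℝ) :
    (y * (1 + Complex.exp (-2 * Complex.I * a))).re =
      2 * Real.cos a * (y * Complex.exp (-Complex.I * a)).re := by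
  rw [two_cos_eq, ← mul_assoc, Complex.re_mul_ofReal, mul_comm]

theorem zeta_null {a : ℝ} (ha : 0 < Real.cos a) : herm (zeta a) (zeta a) = 0 := by
  have ht : ((√(2 * Real.cos a) : ℝ) : ℂ) * (√(2 * Real.cos a) : ℝ) = (2 * Real.cos a : ℝ) := by
    rw [← Complex.ofReal_mul, Real.mul_self_sqrt (by positivity)]
  have h2 : ((2 * Real.cos a : ℝ) : ℂ) =
      Complex.exp (Complex.I * a) + Complex.exp (-Complex.I * a) := by
    push_cast
    rw [Complex.two_cos]
    ring_nf
  have hc := conj_exp_neg_I_mul a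
  simp only [herm_apply, zeta, Complex.star_def, Matrix.cons_val_zero, Matrix.cons_val_one,
    Matrix.cons_val, map_neg, map_one, hc, Complex.conj_ofReal]
  rw [ht, h2]
  ring

theorem omega_null_iff {x₁ x₂ : ℂ} {a : ℝ} (ha : 0 < Real.cos a) :
    herm (omega x₁ x₂ a) (omega x₁ x₂ a) = 0 ↔
      ‖x₁ + x₂ - 1‖ ^ 2 = 2 * (x₁ * star x₂ * (1 + Complex.exp (-2 * Complex.I * a))).re := by
  rw [re_mul_one_add_exp]
  set u := x₁ * star x₂ * Complex.exp (-Complex.I * a) with hu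
  have htt : √(2 * Real.cos a) * √(2 * Real.cos a) = 2 * Real.cos a :=
    Real.mul_self_sqrt (by positivity)
  have h1 : omega x₁ x₂ a 1 * star (omega x₁ x₂ a 1) =
      ((‖x₁ + x₂ - 1‖ ^ 2 / (2 * Real.cos a) : ℝ) : ℂ) := by
    rw [Complex.star_def, Complex.mul_conj]
    congr 1
    simp only [omega, Matrix.cons_val_one, Matrix.cons_val_zero]
    rw [map_div₀, Complex.normSq_neg, Complex.normSq_ofReal, htt, Complex.normSq_eq_norm_sq]
  have h2 : omega x₁ x₂ a 0 * star (omega x₁ x₂ a 2) + omega x₁ x₂ a 2 * star (omega x₁ x₂ a 0) =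
      ((-(2 * u.re) : ℝ) : ℂ) := by
    have : omega x₁ x₂ a 2 * star (omega x₁ x₂ a 0) = -u := by
      simp only [omega, Matrix.cons_val, Matrix.cons_val_zero, hu]
      ring
    have h' : omega x₁ x₂ a 0 * star (omega x₁ x₂ a 2) = -starRingEnd ℂ u := by
      rw [← map_neg, ← this, Complex.star_def, map_mul, Complex.conj_conj,
        mul_comm]
    rw [this, h']
    apply Complex.ext <;> simp
    ring
  rw [herm_apply, show ∀ x y z : ℂ, x + y + z = (x + z) + y by intros; ring, h2, h1,
    ← Complex.ofReal_add, Complex.ofReal_eq_zero]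
  field_simp
  constructor <;> intro h <;> linarith

/-- The quotient x₁/x₂ is a positive multiple of x₁ x̄₂ = u e^{ia}. Both arg u and a lie in (-π/2,
π/2), so their sum stays in (-π, π) and the arguments add without wrapping. -/
theorem arg_div_eq {x₁ x₂ : ℂ} {a : ℝ} (ha : a ∈ Set.Ioo (-(Real.pi / 2)) (Real.pi / 2))
    (h : 0 < (x₁ * star x₂ * Complex.exp (-Complex.I * a)).re) :
    Complex.arg (x₁ / x₂) = Complex.arg (x₁ * star x₂ * Complex.exp (-Complex.I * a)) + a := by
  set u := x₁ * star x₂ * Complex.exp (-Complex.I * a) with hu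
  have hu0 : u ≠ 0 := by
    intro h0
    simp [h0] at h
  have hx2 : x₂ ≠ 0 := by
    rintro rfl
    simp [hu] at hu0
  have hargI : Complex.arg (Complex.exp (Complex.I * a)) = a := by
    rw [mul_comm, Complex.exp_mul_I, Complex.arg_cos_add_sin_mul_I]
    constructor <;> linarith [ha.1, ha.2, Real.pi_pos]
  have hdiv : x₁ / x₂ = (((Complex.normSq x₂)⁻¹ : ℝ) : ℂ) * (u * Complex.exp (Complex.I * a)) := by
    rw [hu, mul_assoc _ _ (Complex.exp (Complex.I * a)), mul_comm (Complex.exp _),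
      exp_I_mul_exp_neg_I, div_eq_mul_inv, Complex.inv_def, Complex.star_def]
    push_cast
    ring
  have hb := abs_lt.1 (Complex.abs_arg_lt_pi_div_two_iff.2 (Or.inl h))
  rw [hdiv, Complex.arg_real_mul _ (inv_pos.2 (Complex.normSq_pos.2 hx2)),
    Complex.arg_mul hu0 (Complex.exp_ne_zero _), hargI]
  rw [hargI]
  constructor <;> linarith [ha.1, ha.2, hb.1, hb.2]

theorem cartan_omega {p q r : boundary} {g : GL (Fin 3) ℂ} (hg : g ∈ U21) {x₁ x₂ : ℂ}
    {a : ℝ} (hp : IsLift p (g • omega x₁ x₂ a)) (hq : IsLift q (g • ![1, 0, 0]))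
    (hr : IsLift r (g • ![0, 0, 1])) :
    cartan p q r = Complex.arg (x₁ * star x₂ * Complex.exp (-Complex.I * a)) := by
  rw [cartan_eq_of_isLift hp hq hr, hg, hg, hg]
  congr 1
  simp [herm_apply, omega]
  ring

/-! ### Normal form of quadruples. -/

/-- Quadruples whose first three points are outside a `ℂ`-circle have a normal form, determined
by the invariants. -/
theorem exists_frame_quadruple {p : C4} (h : ¬ InCommonCCircle (p 0) (p 1) (p 2)) :
    ∃ g ∈ U21, cartan (p 0) (p 1) (p 2) ∈ Set.Ioo (-(Real.pi / 2)) (Real.pi / 2) ∧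
      IsLift (p 0) (g • zeta (cartan (p 0) (p 1) (p 2))) ∧
      IsLift (p 1) (g • ![1, 0, 0]) ∧ IsLift (p 2) (g • ![0, 0, 1]) ∧
      IsLift (p 3) (g • omega (X1 p) (X2 p) (cartan (p 0) (p 1) (p 2))) := by
  obtain ⟨g, hg, a, ha, h0, h1, h2⟩ := exists_frame_triple h (p.injective.ne (by decide))
  have hca := cartan_eq_of_frame hg ha h0 h1 h2
  rw [hca]
  refine ⟨g, hg, ha, h0, h1, h2, ?_⟩
  have hcos : 0 < Real.cos a := Real.cos_pos_of_mem_Ioo ha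
  have h3 : IsLift (p 3) (g • (g⁻¹ • lift (p 3))) := by
    rw [smul_inv_smul]
    exact isLift_lift _
  set w := g⁻¹ • lift (p 3)
  have hc := h3.herm_ne_zero h0 (p.injective.ne (by decide))
  rw [hg] at hc
  have hX1 : X1 p = -(w 2 * Complex.exp (Complex.I * a)) / herm w (zeta a) := by
    rw [X1, crossRatio_eq_of_isLift h0 h1 h2 h3, hg, hg, hg, hg]
    have e1 : herm w ![1, 0, 0] = w 2 := by simp [herm_apply]
    have e2 : herm ![0, 0, 1] (zeta a) = -Complex.exp (Complex.I * a) := by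
      rw [← conj_exp_neg_I_mul]
      simp [herm_apply, zeta]
    have e3 : herm ![0, 0, 1] ![1, 0, 0] = 1 := by simp [herm_apply]
    rw [e1, e2, e3, mul_one, mul_neg]
  have hX2 : X2 p = w 0 / herm w (zeta a) := by
    rw [X2, crossRatio_eq_of_isLift h0 h2 h1 h3, hg, hg, hg, hg]
    have e1 : herm w ![0, 0, 1] = w 0 := by simp [herm_apply]
    have e2 : herm ![1, 0, 0] (zeta a) = 1 := by simp [herm_apply, zeta]
    have e3 : herm ![1, 0, 0] ![0, 0, 1] = 1 := by simp [herm_apply]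
    rw [e1, e2, e3, mul_one, mul_one]
  have hcw : herm w (zeta a) =
      w 0 + w 1 * (√(2 * Real.cos a) : ℝ) - w 2 * Complex.exp (Complex.I * a) := by
    rw [← conj_exp_neg_I_mul, herm_apply]
    simp [zeta]
    ring
  have ht : ((√(2 * Real.cos a) : ℝ) : ℂ) ≠ 0 := by
    exact_mod_cast (Real.sqrt_pos.2 (by positivity)).ne'
  -- After division by ⟨w, `zeta a`⟩, which is nonzero because p₄ ≠ p₁, the cross-ratio formulas
  -- give the outer coordinates, and expanding ⟨w, `zeta a`⟩ gives the middle one.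
  have hw : w = herm w (zeta a) • omega (X1 p) (X2 p) a := by
    rw [hX1, hX2]
    set c := herm w (zeta a)
    ext i
    fin_cases i
    · simp [omega]
      field_simp
    · simp only [omega, Fin.mk_one, Pi.smul_apply, Matrix.cons_val_one, Matrix.cons_val_zero,
        smul_eq_mul]
      field_simp
      rw [hcw]
      ring
    · simp only [omega, Fin.reduceFinMk, Pi.smul_apply, Matrix.cons_val, smul_eq_mul]
      field_simp
      rw [mul_assoc, mul_comm (Complex.exp _), ← neg_mul, exp_I_mul_exp_neg_I, mul_one]
  rw [hw, smul_comm] at h3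
  exact h3.of_smul

/-! ### The bijection. -/

theorem B0_config (p : C4) : B0 (config p) = (X1 p, X2 p, cartan (p 0) (p 1) (p 2)) := rfl

theorem mapsTo_B0 : Set.MapsTo B0 F4'' V4 := by
  rintro _ ⟨p, ⟨hp, hp', horb⟩, rfl⟩
  obtain ⟨g, hg, ha, h0, h1, h2, h3⟩ := exists_frame_quadruple hp
  rw [B0_config]
  set a := cartan (p 0) (p 1) (p 2) with hca
  have hcos : 0 < Real.cos a := Real.cos_pos_of_mem_Ioo ha
  have hp3 : ¬ InCommonCCircle (p 3) (p 1) (p 2) := fun h ↦ hp' h.rotate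
  have h12 : p 1 ≠ p 2 := p.injective.ne (by decide)
  have hc3 := cartan_omega hg h3 h1 h2
  -- Off the ℂ-circle, 𝔸(p₄, p₂, p₃) = arg u has modulus below π/2, so Re u > 0 or u = 0. The latter
  -- is excluded by p₄ ≠ p₂, p₃, which makes both cross-ratios nonzero.
  have hpos : 0 < (X1 p * star (X2 p) * Complex.exp (-Complex.I * a)).re := by
    obtain ⟨g', hg', b, hb, k3, k1, k2⟩ := exists_frame_triple hp3 h12
    rw [cartan_eq_of_frame hg' hb k3 k1 k2] at hc3
    have hlt := abs_lt.2 hb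
    rw [hc3, Complex.abs_arg_lt_pi_div_two_iff] at hlt
    refine hlt.resolve_right ?_
    have e1 := h3.herm_ne_zero h1 (p.injective.ne (by decide))
    have e2 := h3.herm_ne_zero h2 (p.injective.ne (by decide))
    rw [hg] at e1 e2
    simp [herm_apply, omega] at e1 e2
    simp [e1, e2]
  have heq := (omega_null_iff hcos).1 (by rw [← hg, h3.herm_self])
  refine ⟨ha, heq, ?_, hpos, ?_⟩
  -- The right side of the equation is positive, so w₁ + w₂ - 1 cannot vanish.
  · rw [re_mul_one_add_exp] at heq
    intro h
    simp only [h] at heq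
    have : 0 < 2 * (2 * Real.cos a * (X1 p * star (X2 p) * Complex.exp (-Complex.I * a)).re) := by
      positivity
    rw [← heq] at this
    simp at this
  · intro h
    simp only at h
    rw [arg_div_eq ha hpos, ← hc3] at h
    -- Equal Cartan angles would give an element fixing p₂ and p₃ and sending p₁ to p₄, against
    -- (ii).
    obtain ⟨k, hk0, hk1, hk2⟩ := exists_smul_eq_of_cartan_eq hp hp3 h12 (by linarith)
    exact horb ⟨⟨k, hk1, hk2⟩, hk0⟩

theorem injOn_B0 : Set.InjOn B0 F4'' := by
  rintro _ ⟨p, ⟨hp, -, -⟩, rfl⟩ _ ⟨q, ⟨hq, -, -⟩, rfl⟩ h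
  obtain ⟨g, hg, -, h0, h1, h2, h3⟩ := exists_frame_quadruple hp
  obtain ⟨g', hg', -, h0', h1', h2', h3'⟩ := exists_frame_quadruple hq
  rw [B0_config, B0_config, Prod.mk.injEq, Prod.mk.injEq] at h
  obtain ⟨e1, e2, e3⟩ := h
  rw [e3] at h0 h3
  rw [e1, e2] at h3
  -- Equal invariants make the two normal forms identical, so changing frames carries one quadruple
  -- to the other.
  have hk : g * g'⁻¹ ∈ U21 := U21.mul_mem hg (U21.inv_mem hg')
  refine Quotient.sound ⟨toPU _ hk, ?_⟩
  have key : ∀ {x y : boundary} {v : Fin 3 → ℂ}, IsLift x (g' • v) → IsLift y (g • v) →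
      toPU _ hk • x = y := by
    intro x y v hx hy
    refine (hx.toPU_smul hk).unique ?_
    rwa [mul_smul, inv_smul_smul]
  ext1 i
  change toPU _ hk • q i = p i
  fin_cases i
  exacts [key h0' h0, key h1' h1, key h2' h2, key h3' h3]

theorem surjOn_B0 : Set.SurjOn B0 F4'' V4 := by
  rintro ⟨x₁, x₂, a⟩ ⟨ha, heq, hne, hpos, harg⟩
  simp only at ha heq hne hpos harg
  have hcos : 0 < Real.cos a := Real.cos_pos_of_mem_Ioo ha
  have ht : ((√(2 * Real.cos a) : ℝ) : ℂ) ≠ 0 := by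
    exact_mod_cast (Real.sqrt_pos.2 (by positivity)).ne'
  have hx1 : x₁ ≠ 0 := by
    rintro rfl
    simp at hpos
  have hx2 : x₂ ≠ 0 := by
    rintro rfl
    simp at hpos
  have hz : zeta a 1 ≠ 0 := ht
  have hw : omega x₁ x₂ a 1 ≠ 0 := div_ne_zero (neg_ne_zero.2 hne) ht
  have ne_of : ∀ {v : Fin 3 → ℂ}, v 1 ≠ 0 → v ≠ 0 := by
    rintro v hv rfl
    exact hv rfl
  obtain ⟨p₁, h1⟩ := exists_isLift (ne_of hz) (zeta_null hcos)
  obtain ⟨p₂, h2⟩ := exists_isLift (v := ![1, 0, 0])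
    (fun h ↦ by simpa using congrFun h 0) (by simp [herm_apply])
  obtain ⟨p₃, h3⟩ := exists_isLift (v := ![0, 0, 1])
    (fun h ↦ by simpa using congrFun h 2) (by simp [herm_apply])
  obtain ⟨p₄, h4⟩ := exists_isLift (ne_of hw) ((omega_null_iff hcos).2 heq)
  have g12 : herm (zeta a) ![1, 0, 0] = 1 := by simp [herm_apply, zeta]
  have g13 : herm (zeta a) ![0, 0, 1] = -Complex.exp (-Complex.I * a) := by
    simp [herm_apply, zeta]
  have g21 : herm ![1, 0, 0] (zeta a) = 1 := by simp [herm_apply, zeta]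
  have g31 : herm ![0, 0, 1] (zeta a) = -Complex.exp (Complex.I * a) := by
    rw [← conj_exp_neg_I_mul]
    simp [herm_apply, zeta]
  have g23 : herm ![1, 0, 0] ![0, 0, 1] = 1 := by simp [herm_apply]
  have g32 : herm ![0, 0, 1] ![1, 0, 0] = 1 := by simp [herm_apply]
  have g42 : herm (omega x₁ x₂ a) ![1, 0, 0] = -(Complex.exp (-Complex.I * a) * x₁) := by
    simp [herm_apply, omega]
  have g43 : herm (omega x₁ x₂ a) ![0, 0, 1] = x₂ := by simp [herm_apply, omega]
  -- The middle coordinate of `omega` is chosen for this: the three terms are x₂, -(x₁ + x₂ - 1) and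
  -- x₁.
  have g41 : herm (omega x₁ x₂ a) (zeta a) = 1 := by
    have hc := conj_exp_neg_I_mul a
    simp only [herm_apply, omega, zeta, Complex.star_def, Matrix.cons_val_zero,
      Matrix.cons_val_one, Matrix.cons_val, map_neg, map_one, hc, Complex.conj_ofReal]
    rw [div_mul_cancel₀ _ ht]
    linear_combination x₁ * exp_I_mul_exp_neg_I a
  have n12 : p₁ ≠ p₂ := h1.ne_of_herm_ne_zero h2 (by simp [g12])
  have n13 : p₁ ≠ p₃ := h1.ne_of_herm_ne_zero h3 (by simp [g13])
  have n23 : p₂ ≠ p₃ := h2.ne_of_herm_ne_zero h3 (by simp [g23])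
  have n41 : p₄ ≠ p₁ := h4.ne_of_herm_ne_zero h1 (by simp [g41])
  have n42 : p₄ ≠ p₂ := h4.ne_of_herm_ne_zero h2 (by simp [g42, hx1])
  have n43 : p₄ ≠ p₃ := h4.ne_of_herm_ne_zero h3 (by simp [g43, hx2])
  have hinj : Function.Injective ![p₁, p₂, p₃, p₄] := by
    intro i j hij
    fin_cases i <;> fin_cases j <;>
      simp [n12, n13, n23, n41, n42, n43, n12.symm, n13.symm, n23.symm, n41.symm, n42.symm,
        n43.symm] at hij ⊢
  have one_lift : ∀ {p : boundary} {v : Fin 3 → ℂ}, IsLift p v →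
      IsLift p ((1 : GL (Fin 3) ℂ) • v) := fun h ↦ by rwa [one_smul]
  have hcar : cartan p₁ p₂ p₃ = a :=
    cartan_eq_of_frame U21.one_mem ha (one_lift h1) (one_lift h2) (one_lift h3)
  refine ⟨config ⟨_, hinj⟩, ⟨⟨_, hinj⟩, ⟨?_, ?_, ?_⟩, rfl⟩, ?_⟩
  · exact not_inCommonCCircle hz h1 h2 h3
  · exact fun h ↦ not_inCommonCCircle hw h4 h2 h3 h.rotate.rotate
  -- An element fixing p₂ and p₃ preserves the Cartan angle, so it could send p₁ to p₄ only if arg u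
  -- = a, that is, arg(x₁/x₂) = 2a.
  · rintro ⟨⟨k, hk2, hk3⟩, hk⟩
    have hk2' : k • p₂ = p₂ := hk2
    have hk3' : k • p₃ = p₃ := hk3
    have hk' : k • p₁ = p₄ := hk
    have hc := cartan_smul k p₁ p₂ p₃
    rw [hk', hk2', hk3', hcar,
      cartan_omega U21.one_mem (one_lift h4) (one_lift h2) (one_lift h3)] at hc
    apply harg
    rw [arg_div_eq ha hpos, hc]
    ring
  · rw [B0_config, Prod.mk.injEq, Prod.mk.injEq]
    refine ⟨?_, ?_, hcar⟩
    · refine (crossRatio_eq_of_isLift h1 h2 h3 h4).trans ?_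
      rw [g42, g31, g41, g32]
      linear_combination x₁ * exp_I_mul_exp_neg_I a
    · refine (crossRatio_eq_of_isLift h1 h3 h2 h4).trans ?_
      rw [g43, g21, g41, g23]
      ring

end ComplexHyperbolic

end

theorem mainTheorem5 :
    Set.BijOn ComplexHyperbolic.B0 ComplexHyperbolic.F4'' ComplexHyperbolic.V4 :=
  ⟨ComplexHyperbolic.mapsTo_B0, ComplexHyperbolic.injOn_B0, ComplexHyperbolic.surjOn_B0⟩
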